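/- Let $N\ge 1$. Let $\Gamma_N$ be the directed graph whose vertices are the $N$-tuples $\mathbf x=(x_0,\dots,x_{N-1})\in\{0,1\}^N$ and whose edges are as follows: from every $\mathbf x\ne(1,\dots,1)$ there is an edge to the tuple obtained from $\mathbf x$ by replacing its rightmost $0$ with $1$, and from every $\mathbf x\ne(0,\dots,0)$ there is an edge to the tuple obtained from $\mathbf x$ by replacing its rightmost $1$ with $0$. Let $\Gamma_N'$ be the graph obtained from $\Gamma_N$ by adding a self-loop at each of the two vertices $(0,\dots,0)$ and $(1,\dots,1)$. Let $A_N$ and $A_N'$ be the adjacency matrices (of order $2^N$) of $\Gamma_N$ and $\Gamma_N'$, where the entry in row $\mathbf y$ and column $\mathbf x$ is $1$ if there is an edge from $\mathbf x$ to $\mathbf y$, and $0$ otherwise. For $x\in\mathbb R$ let $$F_N(x)=\frac{\#\{\lambda\in\mathrm{sp}(\tfrac12A_N):\lambda<x\}}{2^N},\qquad F_N'(x)=\frac{\#\{\lambda\in\mathrm{sp}(\tfrac12A_N'):\lambda<x\}}{2^N},$$ where $\mathrm{sp}$ denotes the complex spectrum, the eigenvalues are counted with their algebraic multiplicities, and $\lambda<x$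 means that $\lambda$ is real and less than $x$. Let $f:\mathbb R\to\mathbb R$ be the Devil's staircase function $$f(t)=\sum_{k=1}^{\infty}\frac{\lfloor kt\rfloor}{2^k}\quad(0\le t<1),\qquad f(t)=0\quad(t<0),\qquad f(t)=1\quad(t\ge1).$$ Then, for every $x$ with $-1\le x\le 1$, $$\lim_{N\to\infty}F_N(x)=1-f\!\left(\frac1\pi\arccos x\right)\qquad\text{and}\qquad\lim_{N\to\infty}F_N'(x)=1-f\!\left(\frac1\pi\arccos x\right).$$ -/

import Mathlib

open Filter Topology

noncomputable section

namespace Preisach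

/-- A vertex: an `N`-tuple `(x₀, …, x_{N-1})` of zeros (`false`) and ones (`true`). -/
abbrev Vertex (N : ℕ) : Type := Fin N → Bool

/-- `y` is obtained from `x` by replacing the rightmost `0` of `x` with `1`. -/
def Up {N : ℕ} (x y : Vertex N) : Prop :=
  ∃ i : Fin N, x i = false ∧ (∀ k : Fin N, i < k → x k = true) ∧ y = Function.update x i true

/-- `z` is obtained from `x` by replacing the rightmost `1` of `x` with `0`. -/
def Down {N : ℕ} (x z : Vertex N) : Prop :=
  ∃ j : Fin N, x j = true ∧ (∀ k : Fin N, j < k → x k = false) ∧ z = Function.update x j false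

/-- The directed graph `Γ` on `{0,1}^N`; `Adj x y` means that there is an edge from `x` to `y`.
The all-zero vertex has no `Down` successor and the all-one vertex has no `Up` successor. -/
def graph (N : ℕ) : Digraph (Vertex N) where
  Adj x y := Up x y ∨ Down x y

/-- The directed graph `Γ'`: the graph `Γ` with self-loops added at the all-zero vertex and at the
all-one vertex. -/
def graph' (N : ℕ) : Digraph (Vertex N) where
  Adj x y := (graph N).Adj x y ∨ (x = y ∧ ((∀ i, x i = false) ∨ (∀ i, x i = true)))

open Classical in
/-- The adjacency matrix of a directed graph: the entry in row `y` and column `x` is `1` if there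
is an edge from `x` to `y`, and `0` otherwise (columns are indexed by the sources of the edges). -/
def adjacency {V : Type*} (G : Digraph V) : Matrix V V ℂ :=
  Matrix.of fun y x => if G.Adj x y then 1 else 0

/-- The matrix `A_N`, of order `2 ^ N`. -/
def A (N : ℕ) : Matrix (Vertex N) (Vertex N) ℂ := adjacency (graph N)

/-- The matrix `A'_N`, of order `2 ^ N`. -/
def A' (N : ℕ) : Matrix (Vertex N) (Vertex N) ℂ := adjacency (graph' N)

open Classical in
/-- The distribution function of the spectrum of a matrix `M` of order `2 ^ N`: the number of
eigenvalues `lam < x` of `M` (that is, `lam` is real and less than `x`), counted with their algebraic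
multiplicities, divided by `2 ^ N`. -/
def F {N : ℕ} (M : Matrix (Vertex N) (Vertex N) ℂ) (x : ℝ) : ℝ :=
  (Multiset.card (M.charpoly.roots.filter fun lam : ℂ => lam.im = 0 ∧ lam.re < x) : ℝ) / 2 ^ N

/-- The Devil's staircase function: `∑_{k ≥ 1} ⌊k t⌋ / 2 ^ k` for `0 ≤ t < 1`, extended by `0` for
`t < 0` and by `1` for `t ≥ 1`. -/
def devil (t : ℝ) : ℝ :=
  if t < 0 then 0
  else if 1 ≤ t then 1
  else ∑' k : ℕ, (⌊((k : ℝ) + 1) * t⌋ : ℝ) / 2 ^ (k + 1)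

end Preisach

end

/-! ### Determinants of low-rank perturbations -/

namespace Matrix

variable {n K : Type*} [Fintype n] [DecidableEq n] [Field K]

/-! Splitting vertices by their first coordinate makes `A (N + 1)` two copies of `A N` coupled by
two single entries, at the all-zero and all-one vertices (`A_succ`). Its characteristic polynomial
therefore needs only corner entries of the resolvent of `A N / 2`. These are explicit, because on
functions of the number of ones the graph acts like a path, where Chebyshev polynomials solve the
recurrence.

Writing `P_N` for the characteristic polynomial of `A N / 2`, this gives `P_{N+1} U_{N+1}² = P_N²
U_N U_{N+2}` (`charpoly_succ`). If `c_m` counts the roots of `U_m` below `x`, normalized counting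
telescopes to `c_{N+1} / 2^N + ∑_{m<N} c_m / 2^(m+1)` (`F_A_eq`). With `x = cos (tπ)` and `0 ≤ t <
1`, `c_m = m - ⌊(m+1)t⌋`, and `∑ m / 2^(m+1) = 1` yields the limit. The self-loops are a rank-two
perturbation, changing the count by `O(N)`, negligible against `2^N`. -/

theorem det_sub_single {M : Matrix n n K} (hM : IsUnit M.det) (i j : n) (s : K) :
    (M - single i j s).det = M.det * (1 - s * M⁻¹ j i) := by
  have h : M - single i j s
      = M + replicateCol Unit (Pi.single i (1 : K)) * replicateRow Unit (Pi.single j (-s)) := by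
    ext a b
    simp [single_apply, Matrix.mul_apply, Pi.single_apply]
    grind
  rw [h, det_add_mul _ _ hM, det_unique (n := Unit)]
  congr 1
  simp [Matrix.mul_apply, Pi.single_apply]
  ring

/-- The Schur complement of the upper-left block is again `M` minus a single entry. -/
theorem det_fromBlocks_single {M : Matrix n n K} (hM : IsUnit M.det) (i j : n) (s t : K) :
    (fromBlocks M (-single i i s) (-single j j t) M).det =
      M.det ^ 2 * (1 - s * t * M⁻¹ j i * M⁻¹ i j) := by
  have := invertibleOfIsUnitDet M hM
  have h : -single j j t * M⁻¹ * -single i i s = single j i (s * t * M⁻¹ j i) := by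
    ext a b
    simp [Matrix.mul_apply, single_apply, ite_and]
    grind
  rw [det_fromBlocks₁₁, invOf_eq_nonsing_inv, h, det_sub_single hM]
  ring

theorem det_sub_single_sub_single {M : Matrix n n K} (hM : IsUnit M.det) (i j : n) (s : K) :
    (M - (single i i s + single j j s)).det =
      M.det * ((1 - s * M⁻¹ i i) * (1 - s * M⁻¹ j j) - s ^ 2 * M⁻¹ i j * M⁻¹ j i) := by
  let p : Fin 2 → n := ![i, j]
  have h : M - (single i i s + single j j s)
      = M + (1 : Matrix n n K).submatrix id p * (-s • (1 : Matrix n n K).submatrix p id) := by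
    ext a b
    simp only [add_apply, sub_apply, smul_apply, single_apply, Matrix.mul_apply,
      Fin.sum_univ_two, submatrix_apply, one_apply, p, id, smul_eq_mul, cons_val_zero,
      cons_val_one]
    grind
  rw [h, det_add_mul _ _ hM]
  have h2 : (-s • (1 : Matrix n n K).submatrix p id) * M⁻¹ * (1 : Matrix n n K).submatrix id p
      = -s • M⁻¹.submatrix p p := by
    ext a b
    simp [Matrix.mul_apply, one_apply]
  rw [h2, det_fin_two]
  simp only [add_apply, smul_apply, submatrix_apply, one_apply, p, smul_eq_mul, cons_val_zero,
    cons_val_one]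
  norm_num
  ring_nf
  simp

end Matrix

namespace Preisach

/-! ### Recursive structure of the graphs -/

theorem up_cons {N : ℕ} (a b : Bool) (x y : Vertex N) :
    Up (Fin.cons a x : Vertex (N + 1)) (Fin.cons b y) ↔
      (a = b ∧ Up x y) ∨ (a = false ∧ b = true ∧ (∀ k, x k = true) ∧ y = x) := by
  simp only [Up, Fin.exists_fin_succ, Fin.forall_fin_succ, Fin.cons_zero, Fin.cons_succ,
    Fin.update_cons_zero, ← Fin.cons_update, Fin.cons_inj]
  simp
  grind

theorem down_cons {N : ℕ} (a b : Bool) (x y : Vertex N) :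
    Down (Fin.cons a x : Vertex (N + 1)) (Fin.cons b y) ↔
      (a = b ∧ Down x y) ∨ (a = true ∧ b = false ∧ (∀ k, x k = false) ∧ y = x) := by
  simp only [Down, Fin.exists_fin_succ, Fin.forall_fin_succ, Fin.cons_zero, Fin.cons_succ,
    Fin.update_cons_zero, ← Fin.cons_update, Fin.cons_inj]
  simp
  grind

/-- The all-zero vertex. -/
abbrev zeros (N : ℕ) : Vertex N := fun _ => false

/-- The all-one vertex. -/
abbrev ones (N : ℕ) : Vertex N := fun _ => true

theorem A_cons_self {N : ℕ} (a : Bool) (x y : Vertex N) :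
    A (N + 1) (Fin.cons a y) (Fin.cons a x) = A N y x := by
  have : (graph (N + 1)).Adj (Fin.cons a x : Vertex (N + 1)) (Fin.cons a y) ↔
      (graph N).Adj x y := by
    simp only [graph, up_cons, down_cons]
    grind
  simp only [A, adjacency, Matrix.of_apply]
  classical exact if_congr this rfl rfl

theorem A_cons_true_false {N : ℕ} (x y : Vertex N) :
    A (N + 1) (Fin.cons true y) (Fin.cons false x) =
      Matrix.single (ones N) (ones N) (1 : ℂ) y x := by
  have : (graph (N + 1)).Adj (Fin.cons false x : Vertex (N + 1)) (Fin.cons true y) ↔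
      ones N = y ∧ ones N = x := by
    simp only [graph, up_cons, down_cons, funext_iff]
    grind
  simp only [A, adjacency, Matrix.of_apply, this, Matrix.single_apply]

theorem A_cons_false_true {N : ℕ} (x y : Vertex N) :
    A (N + 1) (Fin.cons false y) (Fin.cons true x) =
      Matrix.single (zeros N) (zeros N) (1 : ℂ) y x := by
  have : (graph (N + 1)).Adj (Fin.cons true x : Vertex (N + 1)) (Fin.cons false y) ↔
      zeros N = y ∧ zeros N = x := by
    simp only [graph, up_cons, down_cons, funext_iff]
    grind
  simp only [A, adjacency, Matrix.of_apply, this, Matrix.single_apply]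

/-- Splitting a vertex by its first coordinate. -/
def splitEquiv (N : ℕ) : Vertex N ⊕ Vertex N ≃ Vertex (N + 1) :=
  (Equiv.boolProdEquivSum (Vertex N)).symm.trans (Fin.consEquiv fun _ => Bool)

@[simp] theorem splitEquiv_inl {N : ℕ} (x : Vertex N) :
    splitEquiv N (Sum.inl x) = Fin.cons false x := rfl

@[simp] theorem splitEquiv_inr {N : ℕ} (x : Vertex N) :
    splitEquiv N (Sum.inr x) = Fin.cons true x := rfl

theorem A_succ (N : ℕ) :
    (A (N + 1)).submatrix (splitEquiv N) (splitEquiv N) =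
      Matrix.fromBlocks (A N) (Matrix.single (zeros N) (zeros N) 1)
        (Matrix.single (ones N) (ones N) 1) (A N) := by
  ext (y | y) (x | x) <;>
    simp [A_cons_self, A_cons_true_false, A_cons_false_true]

theorem graph_irrefl {N : ℕ} (x : Vertex N) : ¬ (graph N).Adj x x := by
  rintro (⟨i, hi, -, h⟩ | ⟨i, hi, -, h⟩) <;>
  · have := congrFun h i
    rw [Function.update_self, hi] at this
    contradiction

/-- Order `N + 1` is needed: for `N = 0` the two looped vertices coincide. -/
theorem A'_eq (N : ℕ) :
    A' (N + 1) = A (N + 1) + (Matrix.single (zeros (N + 1)) (zeros (N + 1)) 1 +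
      Matrix.single (ones (N + 1)) (ones (N + 1)) 1) := by
  ext y x
  have h0 : (∀ i, x i = false) ↔ zeros (N + 1) = x :=
    ⟨fun h => (funext h).symm, fun h => congrFun h.symm⟩
  have h1 : (∀ i, x i = true) ↔ ones (N + 1) = x :=
    ⟨fun h => (funext h).symm, fun h => congrFun h.symm⟩
  have hne : zeros (N + 1) ≠ ones (N + 1) := fun h => by simpa using congrFun h 0
  have hx := graph_irrefl x
  simp only [A', A, adjacency, graph', Matrix.add_apply, Matrix.of_apply, Matrix.single_apply, h0,
    h1]
  split_ifs <;> grind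

/-! ### Corner entries of the resolvent via Chebyshev polynomials -/

/-- The number of ones of a vertex. -/
def weight {N : ℕ} (x : Vertex N) : ℤ := ∑ i, if x i then 1 else 0

@[simp] theorem weight_cons {N : ℕ} (a : Bool) (x : Vertex N) :
    weight (Fin.cons a x : Vertex (N + 1)) = (if a then 1 else 0) + weight x := by
  unfold weight
  rw [Fin.sum_univ_succ]
  simp

@[simp] theorem weight_zeros (N : ℕ) : weight (zeros N) = 0 := by simp [weight]

@[simp] theorem weight_ones (N : ℕ) : weight (ones N) = N := by simp [weight]

/-- An up edge raises the weight by one and a down edge lowers it by one. `p` is general because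
prepending a one shifts the weight in the induction. -/
theorem sum_weight_mul_A (N : ℕ) (p : ℤ → ℂ) (x : Vertex N) :
    ∑ y, p (weight y) * A N y x =
      (if x = ones N then 0 else p (weight x + 1)) +
        (if x = zeros N then 0 else p (weight x - 1)) := by
  induction N generalizing p with
  | zero =>
    have h : ∀ x y : Vertex 0, A 0 y x = 0 := fun x y => by
      simp [A, adjacency, graph, Up, Down]
    simp [h, Subsingleton.elim x (ones 0), Subsingleton.elim (ones 0) (zeros 0)]
  | succ N ih =>
    rw [← Equiv.sum_comp (splitEquiv N), Fintype.sum_sum_type]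
    obtain ⟨a, x, rfl⟩ : ∃ a x', x = Fin.cons a x' := ⟨_, _, (Fin.cons_self_tail x).symm⟩
    have h0 : zeros (N + 1) = Fin.cons false (zeros N) := by
      ext i; refine Fin.cases ?_ (fun j => ?_) i <;> simp
    have h1 : ones (N + 1) = Fin.cons true (ones N) := by
      ext i; refine Fin.cases ?_ (fun j => ?_) i <;> simp
    have ih1 := ih (fun k => p (1 + k)) x
    have ih0 := ih p x
    rw [h0, h1]
    cases a
    · simp [A_cons_self, A_cons_true_false, ih0, Matrix.single_apply,
        ite_and, Fin.cons_inj, eq_comm (a := ones N)]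
      split_ifs <;> simp_all [add_comm]
    · simp [A_cons_self, A_cons_false_true, ih1, Matrix.single_apply,
        ite_and, Fin.cons_inj, eq_comm (a := zeros N)]
      split_ifs <;> simp_all [add_comm]

open Polynomial (Chebyshev.U)

/-- The characteristic matrix `z - A_N / 2`. -/
noncomputable def shifted (N : ℕ) (z : ℂ) : Matrix (Vertex N) (Vertex N) ℂ :=
  Matrix.scalar (Vertex N) z - (1 / 2 : ℂ) • A N

open Polynomial.Chebyshev in
theorem U_eval_add_one (n : ℤ) (z : ℂ) :
    (U ℂ (n + 1)).eval z = 2 * z * (U ℂ n).eval z - (U ℂ (n - 1)).eval z := by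
  rw [U_add_one]; simp

theorem vecMul_shifted (N : ℕ) (z : ℂ) (p : ℤ → ℂ) (x : Vertex N) :
    Matrix.vecMul (fun y => p (weight y)) (shifted N z) x =
      z * p (weight x) - ((if x = ones N then 0 else p (weight x + 1)) +
        (if x = zeros N then 0 else p (weight x - 1))) / 2 := by
  rw [← sum_weight_mul_A, shifted, Matrix.vecMul_sub, Matrix.vecMul_smul]
  simp [Matrix.vecMul, dotProduct]
  ring

theorem vecMul_shifted_ones (N : ℕ) (z : ℂ) :
    Matrix.vecMul (fun y => (Chebyshev.U ℂ (weight y)).eval z) (shifted N z) =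
      Pi.single (ones N) ((Chebyshev.U ℂ (N + 1)).eval z / 2) := by
  ext x
  rw [vecMul_shifted N z (fun k => (Chebyshev.U ℂ k).eval z), Pi.single_apply]
  have h := U_eval_add_one (weight x) z
  -- The missing down edge costs nothing since `U (-1) = 0`; only the all-one vertex leaves a
  -- defect.
  have h0 : (if x = zeros N then 0 else (Chebyshev.U ℂ (weight x - 1)).eval z) =
      (Chebyshev.U ℂ (weight x - 1)).eval z := by
    split_ifs with hx
    · simp [hx]
    · rfl
  rw [h0]
  split_ifs with hx
  · subst hx
    rw [weight_ones] at *
    rw [h]; ring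
  · rw [h]; ring

theorem vecMul_shifted_zeros (N : ℕ) (z : ℂ) :
    Matrix.vecMul (fun y => (Chebyshev.U ℂ (N - weight y)).eval z) (shifted N z) =
      Pi.single (zeros N) ((Chebyshev.U ℂ (N + 1)).eval z / 2) := by
  ext x
  rw [vecMul_shifted N z (fun k => (Chebyshev.U ℂ (N - k)).eval z), Pi.single_apply]
  have h := U_eval_add_one (N - weight x) z
  have h0 : (if x = ones N then 0 else (Chebyshev.U ℂ (N - (weight x + 1))).eval z) =
      (Chebyshev.U ℂ (N - weight x - 1)).eval z := by
    split_ifs with hx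
    · simp [hx]
    · rw [sub_add_eq_sub_sub]
  rw [h0, sub_sub_eq_add_sub, add_sub_right_comm]
  split_ifs with hx
  · subst hx
    rw [weight_zeros, sub_zero] at *
    rw [h]; ring
  · rw [h]; ring

theorem inv_row {n : Type*} [Fintype n] [DecidableEq n] {M : Matrix n n ℂ} (hM : IsUnit M.det)
    {v : n → ℂ} {i : n} {u : ℂ} (hu : u ≠ 0) (h : Matrix.vecMul v M = Pi.single i (u / 2)) (j : n) :
    M⁻¹ i j = 2 * v j / u := by
  have h1 : Matrix.vecMul (Pi.single i (u / 2)) M⁻¹ = v := by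
    rw [← h, Matrix.vecMul_vecMul, Matrix.mul_nonsing_inv _ hM, Matrix.vecMul_one]
  have h2 := congrFun h1 j
  rw [Matrix.single_vecMul] at h2
  simp at h2
  rw [← h2]
  field_simp

theorem shifted_det (N : ℕ) (z : ℂ) :
    (shifted N z).det = ((1 / 2 : ℂ) • A N).charpoly.eval z := by
  rw [Matrix.eval_charpoly, shifted]

theorem shifted_succ (N : ℕ) (z : ℂ) :
    (shifted (N + 1) z).submatrix (splitEquiv N) (splitEquiv N) =
      Matrix.fromBlocks (shifted N z) (-Matrix.single (zeros N) (zeros N) (1 / 2))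
        (-Matrix.single (ones N) (ones N) (1 / 2)) (shifted N z) := by
  have h := A_succ N
  ext a b
  have h' := congrFun (congrFun h a) b
  rw [Matrix.submatrix_apply] at h'
  rw [Matrix.submatrix_apply, shifted, Matrix.sub_apply, Matrix.smul_apply, h', shifted]
  rcases a with a | a <;> rcases b with b | b <;>
    simp [Matrix.diagonal_apply, Matrix.single_apply, Fin.cons_inj]

theorem inv_shifted {N : ℕ} {z : ℂ} (hM : IsUnit (shifted N z).det)
    (hu : (Chebyshev.U ℂ (N + 1)).eval z ≠ 0) :
    (shifted N z)⁻¹ (ones N) (zeros N) = 2 / (Chebyshev.U ℂ (N + 1)).eval z ∧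
    (shifted N z)⁻¹ (zeros N) (ones N) = 2 / (Chebyshev.U ℂ (N + 1)).eval z ∧
    (shifted N z)⁻¹ (ones N) (ones N) =
      2 * (Chebyshev.U ℂ N).eval z / (Chebyshev.U ℂ (N + 1)).eval z ∧
    (shifted N z)⁻¹ (zeros N) (zeros N) =
      2 * (Chebyshev.U ℂ N).eval z / (Chebyshev.U ℂ (N + 1)).eval z := by
  refine ⟨?_, ?_, ?_, ?_⟩
  · simpa using inv_row hM hu (vecMul_shifted_ones N z) (zeros N)
  · simpa using inv_row hM hu (vecMul_shifted_zeros N z) (ones N)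
  · simpa using inv_row hM hu (vecMul_shifted_ones N z) (ones N)
  · simpa using inv_row hM hu (vecMul_shifted_zeros N z) (zeros N)

/-! ### Identities between characteristic polynomials -/

theorem U_eval_sq_sub_one (n : ℕ) (z : ℂ) :
    (Chebyshev.U ℂ (n + 1)).eval z ^ 2 - 1 =
      (Chebyshev.U ℂ n).eval z * (Chebyshev.U ℂ (n + 2)).eval z := by
  induction n with
  | zero => simp [Polynomial.Chebyshev.U_two]; ring
  | succ n ih =>
    have h1 := U_eval_add_one (n + 1) z
    have h2 := U_eval_add_one (n + 2) z
    push_cast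
    rw [show (n : ℤ) + 1 + 1 = n + 2 by ring, show (n : ℤ) + 1 - 1 = n by ring] at *
    rw [show (n : ℤ) + 2 - 1 = n + 1 by ring] at h2
    rw [show (n : ℤ) + 1 + 2 = n + 2 + 1 by ring]
    linear_combination ih + (Chebyshev.U ℂ (n + 2)).eval z * h1 -
      (Chebyshev.U ℂ (n + 1)).eval z * h2

theorem U_ne_zero (n : ℕ) : Chebyshev.U ℂ n ≠ 0 :=
  Polynomial.Chebyshev.U_ne_zero ℂ n (by omega)

/-- Lets the resolvent computations ignore the finitely many `z` where a denominator vanishes. -/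
theorem eq_of_eval_eq {P Q D : Polynomial ℂ} (hD : D ≠ 0)
    (h : ∀ z, D.eval z ≠ 0 → P.eval z = Q.eval z) : P = Q := by
  have : D * P = D * Q := by
    refine Polynomial.funext fun z => ?_
    by_cases hz : D.eval z = 0
    · simp [hz]
    · simp [h z hz]
  exact mul_left_cancel₀ hD this

theorem charpoly_succ (N : ℕ) :
    ((1 / 2 : ℂ) • A (N + 1)).charpoly * Chebyshev.U ℂ (N + 1 : ℕ) ^ 2 =
      ((1 / 2 : ℂ) • A N).charpoly ^ 2 * (Chebyshev.U ℂ N * Chebyshev.U ℂ (N + 2 : ℕ)) := by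
  refine eq_of_eval_eq (mul_ne_zero ((1 / 2 : ℂ) • A N).charpoly_monic.ne_zero
    (U_ne_zero (N + 1))) fun z hz => ?_
  rw [Polynomial.eval_mul, mul_ne_zero_iff, ← shifted_det] at hz
  obtain ⟨hM, hu⟩ := hz
  push_cast at *
  obtain ⟨h1, h2, -, -⟩ := inv_shifted (isUnit_iff_ne_zero.mpr hM) hu
  simp only [Polynomial.eval_mul, Polynomial.eval_pow, ← shifted_det, ← U_eval_sq_sub_one]
  rw [← Matrix.det_submatrix_equiv_self (splitEquiv N), shifted_succ,
    Matrix.det_fromBlocks_single (isUnit_iff_ne_zero.mpr hM), h1, h2]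
  field_simp

theorem charpoly' (N : ℕ) :
    ((1 / 2 : ℂ) • A' (N + 1)).charpoly * Chebyshev.U ℂ (N + 2 : ℕ) =
      ((1 / 2 : ℂ) • A (N + 1)).charpoly *
        (Chebyshev.U ℂ (N + 1 : ℕ) * (Polynomial.C 2 * (Polynomial.X - Polynomial.C 1))) := by
  refine eq_of_eval_eq (mul_ne_zero ((1 / 2 : ℂ) • A (N + 1)).charpoly_monic.ne_zero
    (U_ne_zero (N + 1 + 1))) fun z hz => ?_
  rw [Polynomial.eval_mul, mul_ne_zero_iff, ← shifted_det] at hz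
  obtain ⟨hM, hu⟩ := hz
  obtain ⟨h1, h2, h3, h4⟩ := inv_shifted (isUnit_iff_ne_zero.mpr hM) hu
  simp only [Polynomial.eval_mul, ← shifted_det]
  rw [Matrix.eval_charpoly]
  have h : (Matrix.scalar _ z - (1 / 2 : ℂ) • A' (N + 1)) = shifted (N + 1) z -
      (Matrix.single (zeros (N + 1)) (zeros (N + 1)) (1 / 2) +
        Matrix.single (ones (N + 1)) (ones (N + 1)) (1 / 2)) := by
    rw [A'_eq, shifted, smul_add, smul_add, Matrix.smul_single, Matrix.smul_single, smul_eq_mul,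
      mul_one, sub_add_eq_sub_sub]
  rw [h, Matrix.det_sub_single_sub_single (isUnit_iff_ne_zero.mpr hM), h1, h2, h3, h4]
  have e1 := U_eval_sq_sub_one N z
  have e2 := U_eval_add_one (N + 1) z
  push_cast at *
  simp only [add_sub_cancel_right, Polynomial.eval_C, Polynomial.eval_X, Polynomial.eval_sub,
    show (N : ℤ) + 1 + 1 = N + 2 by ring] at *
  field_simp
  linear_combination e1 + (Chebyshev.U ℂ (N + 2)).eval z * e2

/-! ### Counting real roots -/

open Classical in
/-- The number of roots of `P` that are real and less than `x`, counted with multiplicity. -/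
noncomputable def countRoots (x : ℝ) (P : Polynomial ℂ) : ℕ :=
  Multiset.card (P.roots.filter fun lam : ℂ => lam.im = 0 ∧ lam.re < x)

theorem countRoots_mul (x : ℝ) {P Q : Polynomial ℂ} (hP : P ≠ 0) (hQ : Q ≠ 0) :
    countRoots x (P * Q) = countRoots x P + countRoots x Q := by
  simp [countRoots, Polynomial.roots_mul (mul_ne_zero hP hQ)]

theorem countRoots_pow (x : ℝ) (P : Polynomial ℂ) (n : ℕ) :
    countRoots x (P ^ n) = n * countRoots x P := by
  simp [countRoots, Multiset.filter_nsmul]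

theorem roots_U_complex (n : ℕ) :
    (Chebyshev.U ℂ n).roots = (Multiset.range n).map fun k : ℕ =>
      ((Real.cos ((k + 1) * Real.pi / (n + 1)) : ℝ) : ℂ) := by
  have hinj : Set.InjOn (fun k : ℕ => Real.cos ((k + 1) * Real.pi / (n + 1))) (Finset.range n) :=
    (Finset.range n).nodup_map_iff_injOn.mp (Polynomial.Chebyshev.roots_U_real_nodup n)
  have hr : (Chebyshev.U ℝ n).roots = (Multiset.range n).map fun k : ℕ =>
      Real.cos ((k + 1) * Real.pi / (n + 1)) := by
    rw [Polynomial.Chebyshev.roots_U_real, Finset.image_val_of_injOn hinj, Finset.range_val]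
  have hs : (Chebyshev.U ℝ n).Splits := by
    rw [Polynomial.splits_iff_card_roots, hr, Polynomial.Chebyshev.natDegree_U_natCast]
    simp
  rw [← Polynomial.Chebyshev.map_U Complex.ofRealHom, hs.roots_map, hr, Multiset.map_map]
  rfl

theorem countRoots_U (x : ℝ) (n : ℕ) :
    countRoots x (Chebyshev.U ℂ n) =
      ((Finset.range n).filter fun k : ℕ => Real.cos ((k + 1) * Real.pi / (n + 1)) < x).card := by
  rw [countRoots, roots_U_complex, Multiset.filter_map, Multiset.card_map]
  simp only [Function.comp_def, Complex.ofReal_im, Complex.ofReal_re, true_and]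
  rw [Finset.card_def, Finset.filter_val, Finset.range_val]

theorem countRoots_U_le (x : ℝ) (n : ℕ) : countRoots x (Chebyshev.U ℂ n) ≤ n := by
  rw [countRoots_U]
  exact (Finset.card_filter_le _ _).trans (by simp)

theorem countRoots_U_eq {t : ℝ} (ht : 0 ≤ t) (ht1 : t < 1) (n : ℕ) :
    (countRoots (Real.cos (t * Real.pi)) (Chebyshev.U ℂ n) : ℝ) =
      n - (⌊((n : ℝ) + 1) * t⌋ : ℝ) := by
  have hpi := Real.pi_pos
  have hn : (0 : ℝ) < n + 1 := by positivity
  have hnn : 0 ≤ ((n : ℝ) + 1) * t := by positivity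
  have hle : ⌊((n : ℝ) + 1) * t⌋₊ ≤ n := by
    rw [← Nat.lt_succ_iff, Nat.floor_lt hnn]
    push_cast
    nlinarith
  have : ((Finset.range n).filter fun k : ℕ =>
      Real.cos ((k + 1) * Real.pi / (n + 1)) < Real.cos (t * Real.pi)) =
      Finset.Ico ⌊((n : ℝ) + 1) * t⌋₊ n := by
    ext k
    rw [Finset.mem_filter, Finset.mem_range, Finset.mem_Ico, and_comm]
    refine and_congr_left fun hk => ?_
    have hk' : (k : ℝ) + 1 ≤ n := by exact_mod_cast hk
    -- Cosine decreases on `[0, π]`, so the condition is `(n + 1) t < k + 1`, that is `⌊(n + 1) t⌋ ≤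
    -- k`.
    rw [Real.strictAntiOn_cos.lt_iff_gt ?_ ?_, lt_div_iff₀ hn, ← Nat.lt_succ_iff,
      Nat.floor_lt hnn, mul_right_comm, mul_lt_mul_iff_left₀ hpi]
    · push_cast
      rw [mul_comm]
    · refine ⟨by positivity, ?_⟩
      rw [div_le_iff₀ hn]
      nlinarith
    · exact ⟨by positivity, by nlinarith⟩
  rw [countRoots_U, this, Nat.card_Ico, Nat.cast_sub hle, natCast_floor_eq_intCast_floor hnn]

theorem countRoots_neg_one_U (n : ℕ) : countRoots (-1) (Chebyshev.U ℂ n) = 0 := by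
  rw [countRoots_U, Finset.card_eq_zero, Finset.filter_eq_empty_iff]
  exact fun k _ => not_lt.mpr (Real.neg_one_le_cos _)

theorem charpoly_A_zero : ((1 / 2 : ℂ) • A 0).charpoly = Polynomial.X := by
  have : A 0 = 0 := by
    ext x y
    simp [A, adjacency, graph, Up, Down]
  simp [this, Matrix.charpoly_zero]

/-- Base of the telescoping: `X` and `U_1 = 2X` have the same roots. -/
theorem countRoots_A_zero (x : ℝ) :
    countRoots x ((1 / 2 : ℂ) • A 0).charpoly = countRoots x (Chebyshev.U ℂ (1 : ℕ)) := by
  rw [charpoly_A_zero, Nat.cast_one, Polynomial.Chebyshev.U_one,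
    show (2 : Polynomial ℂ) = Polynomial.C 2 from rfl,
    countRoots_mul x (by simp) Polynomial.X_ne_zero]
  simp [countRoots]

theorem countRoots_A_succ (x : ℝ) (N : ℕ) :
    countRoots x ((1 / 2 : ℂ) • A (N + 1)).charpoly +
        2 * countRoots x (Chebyshev.U ℂ (N + 1 : ℕ)) =
      2 * countRoots x ((1 / 2 : ℂ) • A N).charpoly +
        (countRoots x (Chebyshev.U ℂ N) + countRoots x (Chebyshev.U ℂ (N + 2 : ℕ))) := by
  have h := congrArg (countRoots x) (charpoly_succ N)
  have hne (M : ℕ) := ((1 / 2 : ℂ) • A M).charpoly_monic.ne_zero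
  rwa [countRoots_mul x (hne _) (pow_ne_zero _ (U_ne_zero _)),
    countRoots_mul x (pow_ne_zero _ (hne _)) (mul_ne_zero (U_ne_zero _) (U_ne_zero _)),
    countRoots_mul x (U_ne_zero _) (U_ne_zero _), countRoots_pow, countRoots_pow] at h

/-- The extra eigenvalue `1` is not counted, as it is not strictly below `x`. -/
theorem countRoots_A' {x : ℝ} (hx : x ≤ 1) (N : ℕ) :
    countRoots x ((1 / 2 : ℂ) • A' (N + 1)).charpoly +
        countRoots x (Chebyshev.U ℂ (N + 2 : ℕ)) =
      countRoots x ((1 / 2 : ℂ) • A (N + 1)).charpoly +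
        countRoots x (Chebyshev.U ℂ (N + 1 : ℕ)) := by
  have h := congrArg (countRoots x) (charpoly' N)
  have hX : Polynomial.X - Polynomial.C (1 : ℂ) ≠ 0 := Polynomial.X_sub_C_ne_zero 1
  have hC : Polynomial.C (2 : ℂ) ≠ 0 := by simp
  have h1 : countRoots x (Polynomial.X - Polynomial.C 1) = 0 := by
    rw [countRoots, Polynomial.roots_X_sub_C]
    simpa [Multiset.filter_singleton] using hx
  have h2 : countRoots x (Polynomial.C 2) = 0 := by simp [countRoots]
  rwa [countRoots_mul x (Matrix.charpoly_monic _).ne_zero (U_ne_zero _),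
    countRoots_mul x (Matrix.charpoly_monic _).ne_zero
      (mul_ne_zero (U_ne_zero _) (mul_ne_zero hC hX)),
    countRoots_mul x (U_ne_zero _) (mul_ne_zero hC hX), countRoots_mul x hC hX, h1, h2,
    add_zero, add_zero] at h

/-! ### Distribution functions and their limits -/

theorem F_A_eq (x : ℝ) (N : ℕ) :
    F ((1 / 2 : ℂ) • A N) x =
      (countRoots x (Chebyshev.U ℂ (N + 1 : ℕ)) : ℝ) / 2 ^ N +
        ∑ m ∈ Finset.range N, (countRoots x (Chebyshev.U ℂ m) : ℝ) / 2 ^ (m + 1) := by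
  change (countRoots x _ : ℝ) / 2 ^ N = _
  induction N with
  | zero => rw [countRoots_A_zero]; simp
  | succ N ih =>
    have h : (_ : ℝ) = _ := congrArg Nat.cast (countRoots_A_succ x N)
    push_cast at h
    rw [Finset.sum_range_succ]
    -- The increment is `c_N / 2^(N+1)` plus the telescoping difference `c_{N+2} / 2^(N+1) - c_{N+1}
    -- / 2^N`.
    have h2 : (countRoots x ((1 / 2 : ℂ) • A (N + 1)).charpoly : ℝ) / 2 ^ (N + 1) =
      (countRoots x ((1 / 2 : ℂ) • A N).charpoly : ℝ) / 2 ^ N +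
      ((countRoots x (Chebyshev.U ℂ N) : ℝ) + countRoots x (Chebyshev.U ℂ (N + 2 : ℕ)) -
        2 * countRoots x (Chebyshev.U ℂ (N + 1 : ℕ))) / 2 ^ (N + 1) := by
      push_cast
      field_simp
      linear_combination 2 ^ N * h
    rw [h2, ih]
    push_cast
    field_simp
    rw [show (N : ℤ) + 1 + 1 = N + 2 by ring]
    ring

theorem tendsto_countRoots_U_div (x : ℝ) (c : ℕ) :
    Tendsto (fun N : ℕ => (countRoots x (Chebyshev.U ℂ (N + c : ℕ)) : ℝ) / 2 ^ N) atTop (𝓝 0) := by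
  have h0 : Tendsto (fun N : ℕ => ((N : ℝ) / 2 ^ N)) atTop (𝓝 0) := by
    simpa using tendsto_pow_const_div_const_pow_of_one_lt 1 (one_lt_two (α := ℝ))
  have h1 : Tendsto (fun N : ℕ => ((c : ℝ) / 2 ^ N)) atTop (𝓝 0) :=
    tendsto_const_nhds.div_atTop (tendsto_pow_atTop_atTop_of_one_lt one_lt_two)
  refine squeeze_zero (fun N => by positivity) (fun N => ?_) (by simpa using h0.add h1)
  rw [← add_div]
  gcongr
  exact_mod_cast countRoots_U_le x (N + c)

theorem hasSum_countRoots_U {x : ℝ} (hx : x ∈ Set.Icc (-1 : ℝ) 1) :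
    HasSum (fun m : ℕ => (countRoots x (Chebyshev.U ℂ m) : ℝ) / 2 ^ (m + 1))
      (1 - devil (Real.arccos x / Real.pi)) := by
  have hpi := Real.pi_pos
  set t := Real.arccos x / Real.pi with ht
  have ht0 : 0 ≤ t := div_nonneg (Real.arccos_nonneg x) hpi.le
  have hxt : x = Real.cos (t * Real.pi) := by
    rw [ht, div_mul_cancel₀ _ hpi.ne', Real.cos_arccos hx.1 hx.2]
  -- At `t = 1`, i.e. `x = -1`, the staircase is `1` by convention and no root lies below `x`.
  by_cases ht1 : 1 ≤ t
  · have ht2 : t = 1 := le_antisymm ((div_le_one hpi).mpr (Real.arccos_le_pi x)) ht1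
    have hx1 : x = -1 := by rw [hxt, ht2, one_mul, Real.cos_pi]
    simp [devil, ht2, hx1, countRoots_neg_one_U, not_lt.mpr (zero_le_one (α := ℝ))]
  · have hlt := not_le.mp ht1
    have hsum : HasSum (fun m : ℕ => (m : ℝ) / 2 ^ (m + 1)) 1 := by
      have := (hasSum_coe_mul_geometric_of_norm_lt_one (𝕜 := ℝ) (r := 1 / 2)
        (by norm_num)).div_const 2
      convert! this using 1
      · ext m
        rw [pow_succ, one_div, inv_pow]
        field_simp
      · norm_num
    have heq (m : ℕ) : (⌊((m : ℝ) + 1) * t⌋ : ℝ) / 2 ^ (m + 1) =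
        (m : ℝ) / 2 ^ (m + 1) - (countRoots x (Chebyshev.U ℂ m) : ℝ) / 2 ^ (m + 1) := by
      rw [hxt, countRoots_U_eq ht0 hlt]
      ring
    have hs : Summable fun m : ℕ => (countRoots x (Chebyshev.U ℂ m) : ℝ) / 2 ^ (m + 1) := by
      refine hsum.summable.of_nonneg_of_le (fun m => by positivity) fun m => ?_
      gcongr
      exact_mod_cast countRoots_U_le x m
    have hd : devil t = 1 - ∑' m : ℕ, (countRoots x (Chebyshev.U ℂ m) : ℝ) / 2 ^ (m + 1) := by
      rw [devil, if_neg (not_lt.mpr ht0), if_neg ht1]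
      simp only [heq]
      rw [hsum.summable.tsum_sub hs, hsum.tsum_eq]
    rw [hd, sub_sub_cancel]
    exact hs.hasSum

theorem tendsto_F_A {x : ℝ} (hx : x ∈ Set.Icc (-1 : ℝ) 1) :
    Tendsto (fun N : ℕ => F ((1 / 2 : ℂ) • A N) x) atTop
      (𝓝 (1 - devil (Real.arccos x / Real.pi))) := by
  simp only [F_A_eq]
  simpa using (tendsto_countRoots_U_div x 1).add (hasSum_countRoots_U hx).tendsto_sum_nat

theorem tendsto_F_A' {x : ℝ} (hx : x ∈ Set.Icc (-1 : ℝ) 1) :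
    Tendsto (fun N : ℕ => F ((1 / 2 : ℂ) • A' N) x) atTop
      (𝓝 (1 - devil (Real.arccos x / Real.pi))) := by
  rw [← tendsto_add_atTop_iff_nat 1]
  have h (N : ℕ) : F ((1 / 2 : ℂ) • A' (N + 1)) x = F ((1 / 2 : ℂ) • A (N + 1)) x +
      ((countRoots x (Chebyshev.U ℂ (N + 1 : ℕ)) : ℝ) / 2 ^ N -
        (countRoots x (Chebyshev.U ℂ (N + 2 : ℕ)) : ℝ) / 2 ^ N) / 2 := by
    have h : (_ : ℝ) = _ := congrArg Nat.cast (countRoots_A' hx.2 N)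
    rw [Nat.cast_add (R := ℝ), Nat.cast_add (R := ℝ)] at h
    change (countRoots x _ : ℝ) / 2 ^ (N + 1) = (countRoots x _ : ℝ) / 2 ^ (N + 1) + _
    rw [pow_succ]
    field_simp
    linear_combination h
  simp only [h]
  simpa using ((tendsto_add_atTop_iff_nat 1).mpr (tendsto_F_A hx)).add
    (((tendsto_countRoots_U_div x 1).sub (tendsto_countRoots_U_div x 2)).div_const 2)

end Preisach

theorem theorem3 (x : ℝ) (hx : x ∈ Set.Icc (-1 : ℝ) 1) :
    Tendsto (fun N : ℕ => Preisach.F ((1 / 2 : ℂ) • Preisach.A N) x) atTop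
      (𝓝 (1 - Preisach.devil (Real.arccos x / Real.pi))) ∧
    Tendsto (fun N : ℕ => Preisach.F ((1 / 2 : ℂ) • Preisach.A' N) x) atTop
      (𝓝 (1 - Preisach.devil (Real.arccos x / Real.pi))) :=
  ⟨Preisach.tendsto_F_A hx, Preisach.tendsto_F_A' hx⟩
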